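/- **Setting.** Let $(X,d)$ be a metric space with a Borel measure $\mu$. Write $B(x,r)=\{y: d(x,y)<r\}$. Assume that $\mu$ is doubling: $0<\mu(B(x,r))<\infty$ and $\mu(B(x,2r))\le C_d\,\mu(B(x,r))$ for all $x\in X$, $r>0$. Assume moreover that $\mu$ is $\delta$-reverse doubling: there is $c_\delta>0$ with $c_\delta (R/r)^\delta\mu(B(x,r))\le \mu(B(y,R))$ whenever $B(x,r)\subset B(y,R)$, $r>0$ and $0<R<\operatorname{diam}X$. Let $\Omega\subset X$ be a bounded John domain, that is, a nonempty bounded open connected set for which there are $x_0\in\Omega$ and $c_J>0$ such that every $x\in\Omega$ can be joined to $x_0$ by a rectifiable curve $\gamma:[0,l]\to\Omega$ parametrized by arc length with $\gamma(0)=x$, $\gamma(l)=x_0$ and $d(\gamma(t),\partial\Omega)\ge t/c_J$ for $t\in[0,l]$. Write $d(x)=d(x,\partial\Omega)$, and assume that there is $\kappa>0$ with $B(x,\kappa\, d(x))\subset\Omega$ for all $x\in\Omega$ (this holds automatically if, for example, $X$ is a length space). Let $F\subset\partial\Omega$ be a nonempty compact set and $d_F(x)=d(x,F)$. Let $\phi:(0,\infty)\to(0,\infty)$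 be nondecreasing with $\phi(2t)\le K\phi(t)$ for some constant $K$ and all $t>0$, and such that $\phi(d_F)\in L^1_{loc}(\Omega,d\mu)$. **Theorem.** Let $1\le p<\infty$, $0<s\le\delta$ and $\tau\in(0,1)$. Then there is a constant $C<\infty$ such that for every $\mu$-measurable $u:\Omega\to\mathbb R$ (in particular for every $u\in W^{s,p}(\Omega,\mu)$) $$\inf_{a\in\mathbb R}\|u-a\|_{L^p(\Omega,\phi(d_F)\,d\mu)}\le C\left(\int_\Omega\int_{\{z\in\Omega:\ d(z,y)\le\tau d(y)\}}\frac{|u(z)-u(y)|^p\;v(z,y)}{\mu[B(z,d(z,y))]\,d(z,y)^{sp}}\,d\mu(z)\,d\mu(y)\right)^{1/p},$$ where $v(z,y)=\min_{x\in\{z,y\}}d(x)^{sp}\,\phi(d_F(x))$, and both sides take values in $[0,\infty]$. -/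

import Mathlib

open MeasureTheory Set Metric
open scoped ENNReal NNReal

/-- A doubling measure: every ball of positive radius has positive and finite measure, and
`μ (2B) ≤ C μ (B)` for every ball `B`, with a constant `C` that depends only on `μ`. -/
def IsDoublingMeasure {X : Type*} [MetricSpace X] [MeasurableSpace X] (μ : Measure X) : Prop :=
  (∀ (x : X) (r : ℝ), 0 < r → 0 < μ (ball x r) ∧ μ (ball x r) < ∞) ∧
    ∃ C : ℝ≥0, ∀ (x : X) (r : ℝ), 0 < r → μ (ball x (2 * r)) ≤ C * μ (ball x r)

/-- A `δ`-reverse doubling measure: `c (R / r) ^ δ ≤ μ (B(y, R)) / μ (B(x, r))` for every pair of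
balls `B(x, r) ⊆ B(y, R)`. As for Ahlfors regularity, only radii `R < diam X` are tested (no
restriction if `X` is unbounded), since no bounded space could satisfy the inequality for all
radii. -/
def IsReverseDoublingMeasure {X : Type*} [MetricSpace X] [MeasurableSpace X] (μ : Measure X)
    (δ : ℝ) : Prop :=
  ∃ c : ℝ, 0 < c ∧ ∀ (x y : X) (r R : ℝ), 0 < r → 0 < R →
    ENNReal.ofReal R < Metric.ediam (univ : Set X) → ball x r ⊆ ball y R →
      ENNReal.ofReal (c * (R / r) ^ δ) * μ (ball x r) ≤ μ (ball y R)

/-- The distance `d(x) = d(x, ∂Ω)` to the boundary of `Ω`. -/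
noncomputable def bdryDist {X : Type*} [MetricSpace X] (Ω : Set X) (x : X) : ℝ :=
  infDist x (frontier Ω)

/-- `Ω` is a bounded John domain: a bounded, open, connected, nonempty set with a central point
`x₀` and a constant `c > 0` such that each `x ∈ Ω` is joined to `x₀` inside `Ω` by a rectifiable
curve `γ : [0, l] → Ω`, parametrized by arc length, with `d(γ(t), ∂Ω) ≥ t / c`. -/
def IsBoundedJohnDomain {X : Type*} [MetricSpace X] (Ω : Set X) : Prop :=
  IsOpen Ω ∧ IsConnected Ω ∧ Bornology.IsBounded Ω ∧
    ∃ x₀ ∈ Ω, ∃ c : ℝ, 0 < c ∧ ∀ x ∈ Ω, ∃ (l : ℝ) (γ : ℝ → X), 0 ≤ l ∧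
      HasUnitSpeedOn γ (Icc 0 l) ∧ MapsTo γ (Icc 0 l) Ω ∧ γ 0 = x ∧ γ l = x₀ ∧
      ∀ t ∈ Icc 0 l, t / c ≤ bdryDist Ω (γ t)

/-- The weight `v(x, y) = min_{z ∈ {x, y}} d(z) ^ q * Φ (d_F(z))`. -/
noncomputable def minWeight {X : Type*} [MetricSpace X] (Ω F : Set X) (Φ : ℝ → ℝ) (q : ℝ)
    (x y : X) : ℝ :=
  min (bdryDist Ω x ^ q * Φ (infDist x F)) (bdryDist Ω y ^ q * Φ (infDist y F))

/-- The measure `φ(d_F) dμ` on `Ω`. -/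
noncomputable def weightedMeasure {X : Type*} [MetricSpace X] [MeasurableSpace X] (μ : Measure X)
    (Ω F : Set X) (φ : ℝ → ℝ) : Measure X :=
  (μ.restrict Ω).withDensity fun x => ENNReal.ofReal (φ (infDist x F))

/-- The truncated weighted fractional seminorm
`(∫_Ω ∫_{Ω ∩ {d(z, y) ≤ τ d(y)}} |u z - u y| ^ p v(z, y) / (μ(B(z, d(z, y))) d(z, y) ^ (s p))
dμ(z) dμ(y)) ^ (1 / p)`, with values in `[0, ∞]` (the integrand is `0` on the diagonal). -/
noncomputable def truncSeminorm {X : Type*} [MetricSpace X] [MeasurableSpace X] (μ : Measure X)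
    (Ω : Set X) (s p τ : ℝ) (v : X → X → ℝ) (u : X → ℝ) : ℝ≥0∞ :=
  (∫⁻ y in Ω, ∫⁻ z in Ω ∩ {z | dist z y ≤ τ * bdryDist Ω y},
    ENNReal.ofReal (|u z - u y| ^ p * v z y) /
      (μ (ball z (dist z y)) * ENNReal.ofReal (dist z y ^ (s * p))) ∂μ ∂μ) ^ (1 / p)

/-! ### Topological and metric consequences of doubling. -/

section Doubling

variable {X : Type*} [MetricSpace X] [MeasurableSpace X] {μ : Measure X}

/-! Write `V(y) = μ(B(y, d(y)))` and `w = φ(d_F)`, and let `Λ(y)` be the integral of `k y` near `y`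
divided by `V(y)`. Suppose `f y ≤ f z + k y z` for all `y, z`. Follow a John curve from `x` to the
centre through points `a i`, and average this inequality over the balls `B(a i, e d(a i))`. Then `f
x` is at most the mean of `f` on the central ball plus a multiple of `Λ(x)` and of the sum of the
means of `Λ` along the chain. Since `d(a i)` grows geometrically, each point lies in boundedly many
of these balls, and the sum is controlled by the integral of `Λ / V` over `{y | d(x, y) ≤ N d(y)}`
(`exists_sum_setLAverage_le`).

Integrate against `w` and exchange the integrals. For fixed `y` the admissible `x` fill a set of
measure at most `C V(y)`, on which `w x ≤ C w y`, because `d ≤ d_F` and `φ` is nondecreasing and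
doubling. The result, `IsBoundedJohnDomain.exists_lintegral_le`, is an estimate linear in `k`.

The power `p` enters through `f = min(|u - a|, n) ^ p` and `k y z = ε f(z) + C |u z - u y| ^ p`. The
`ε` term is absorbed on the left, which is legitimate because the truncation makes it finite; then
`n → ∞`. The constant `a` is a suitable value of `u`. Finally the energy is compared with the
fractional seminorm, whose kernel dominates `w(y) / V(y)` up to a constant when `d(z, y) ≤ θ d(y)`.
-/

lemma IsDoublingMeasure.sigmaFinite (hμ : IsDoublingMeasure μ) : SigmaFinite μ := by
  rcases isEmpty_or_nonempty X with h | ⟨⟨x⟩⟩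
  · rw [Measure.eq_zero_of_isEmpty μ]
    infer_instance
  · refine ⟨⟨⟨fun n : ℕ => ball x (n + 1), fun _ => trivial,
      fun n => (hμ.1 x _ (by positivity)).2, ?_⟩⟩⟩
    refine eq_univ_of_forall fun y => mem_iUnion.2 ?_
    obtain ⟨n, hn⟩ := exists_nat_gt (dist y x)
    exact ⟨n, mem_ball.2 (hn.trans (by linarith))⟩

/-- A maximal `ε`-separated set is `ε`-dense, and it is countable because the disjoint balls around
its points have positive measure for a σ-finite `μ`. This supplies the joint measurability needed
for Tonelli. -/
lemma IsDoublingMeasure.secondCountableTopology [OpensMeasurableSpace X]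
    (hμ : IsDoublingMeasure μ) : SecondCountableTopology X := by
  have := hμ.sigmaFinite
  refine secondCountable_of_almost_dense_set fun ε hε => ?_
  obtain ⟨S, hS⟩ := zorn_subset {S : Set X | S.Pairwise fun x y => ε ≤ dist x y} (by
    intro c hc hchain
    refine ⟨⋃₀ c, ?_, fun s hs => subset_sUnion_of_mem hs⟩
    exact (pairwise_sUnion hchain.directedOn).2 fun s hs => hc hs)
  have hsep : S.Pairwise fun x y => ε ≤ dist x y := hS.prop
  refine ⟨S, ?_, fun x => ?_⟩
  · have h := Measure.countable_meas_pos_of_disjoint_iUnion (μ := μ)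
      (As := fun i : S => ball (i : X) (ε / 2)) (fun _ => isOpen_ball.measurableSet) (by
        intro i j hij
        refine ball_disjoint_ball ?_
        have := hsep i.2 j.2 (fun h => hij (Subtype.ext h))
        linarith)
    have h2 : {i : S | 0 < μ (ball (i : X) (ε / 2))} = univ :=
      eq_univ_of_forall fun i => (hμ.1 i _ (by positivity)).1
    rw [h2] at h
    exact countable_coe_iff.1 (countable_univ_iff.1 h)
  · by_contra! hx
    have hmem : insert x S ∈ {S : Set X | S.Pairwise fun x y => ε ≤ dist x y} := by
      refine hsep.insert fun y hy _ => ⟨(hx y hy).le, ?_⟩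
      rw [dist_comm]
      exact (hx y hy).le
    have hxS : x ∈ S := hS.le_of_ge hmem (subset_insert x S) (mem_insert x S)
    have := hx x hxS
    rw [dist_self] at this
    linarith

lemma IsDoublingMeasure.measure_ball_le (hμ : IsDoublingMeasure μ) (N : ℝ) :
    ∃ C : ℝ≥0, ∀ (x y : X) (r R : ℝ), 0 < r → R ≤ N * r → dist x y ≤ N * r →
      μ (ball y R) ≤ C * μ (ball x r) := by
  obtain ⟨-, D, hD⟩ := hμ
  have hpow : ∀ (n : ℕ) (x : X) (r : ℝ), 0 < r →
      μ (ball x (2 ^ n * r)) ≤ (D : ℝ≥0∞) ^ n * μ (ball x r) := by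
    intro n
    induction n with
    | zero => intro x r _; simp
    | succ n ih =>
      intro x r hr
      calc μ (ball x (2 ^ (n + 1) * r)) = μ (ball x (2 * (2 ^ n * r))) := by
            rw [pow_succ]; ring_nf
        _ ≤ D * μ (ball x (2 ^ n * r)) := hD x _ (by positivity)
        _ ≤ D * (D ^ n * μ (ball x r)) := by gcongr; exact ih x r hr
        _ = D ^ (n + 1) * μ (ball x r) := by rw [pow_succ]; ring
  obtain ⟨n, hn⟩ := pow_unbounded_of_one_lt (2 * N) (one_lt_two (α := ℝ))
  refine ⟨D ^ n, fun x y r R hr hR hxy => ?_⟩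
  push_cast
  refine (measure_mono ?_).trans (hpow n x r hr)
  refine ball_subset_ball' ?_
  rw [dist_comm]
  nlinarith

end Doubling

/-! ### Elementary inequalities for `φ` and for powers. -/

section Growth

lemma exists_le_mul_of_doubling {φ : ℝ → ℝ} (hpos : ∀ t : ℝ, 0 < t → 0 < φ t)
    (hmono : MonotoneOn φ (Ioi 0)) (hgrowth : ∃ K : ℝ, ∀ t : ℝ, 0 < t → φ (2 * t) ≤ K * φ t)
    (N : ℝ) : ∃ C : ℝ, 0 < C ∧ ∀ s t : ℝ, 0 < s → 0 < t → s ≤ N * t → φ s ≤ C * φ t := by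
  obtain ⟨K, hK⟩ := hgrowth
  have hK0 : 0 < K := by
    have h1 := hK 1 one_pos
    have h2 := hpos (2 * 1) (by norm_num)
    have h3 := hpos 1 one_pos
    by_contra! h
    nlinarith
  have hpow : ∀ (n : ℕ) (t : ℝ), 0 < t → φ (2 ^ n * t) ≤ K ^ n * φ t := by
    intro n
    induction n with
    | zero => intro t _; simp
    | succ n ih =>
      intro t ht
      calc φ (2 ^ (n + 1) * t) = φ (2 * (2 ^ n * t)) := by rw [pow_succ]; ring_nf
        _ ≤ K * φ (2 ^ n * t) := hK _ (by positivity)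
        _ ≤ K * (K ^ n * φ t) := by gcongr; exact ih t ht
        _ = K ^ (n + 1) * φ t := by rw [pow_succ]; ring
  obtain ⟨n, hn⟩ := pow_unbounded_of_one_lt N (one_lt_two (α := ℝ))
  refine ⟨K ^ n, by positivity, fun s t hs ht hst => ?_⟩
  refine (hmono hs (mem_Ioi.2 (by positivity)) ?_).trans (hpow n t ht)
  nlinarith

/-- Either `b ≤ t a`, and `(1 + t) ^ p < 1 + ε` for small `t`, or `a ≤ t⁻¹ b`. A leading constant
close to `1` is what permits the later absorption. -/
lemma exists_add_rpow_le {p ε : ℝ} (hp : 0 < p) (hε : 0 < ε) :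
    ∃ C : ℝ≥0, ∀ a b : ℝ≥0∞, (a + b) ^ p ≤ (1 + ENNReal.ofReal ε) * a ^ p + C * b ^ p := by
  obtain ⟨t, ht0, ht⟩ : ∃ t : ℝ, 0 < t ∧ (1 + t) ^ p < 1 + ε := by
    have hc : Filter.Tendsto (fun t : ℝ => (1 + t) ^ p) (nhdsWithin 0 (Ioi 0)) (nhds 1) := by
      have h : ContinuousAt (fun t : ℝ => (1 + t) ^ p) 0 :=
        ContinuousAt.rpow_const (by fun_prop) (Or.inr hp.le)
      have h2 := h.tendsto
      simp only [add_zero, Real.one_rpow] at h2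
      exact h2.mono_left nhdsWithin_le_nhds
    have h1 := hc.eventually (gt_mem_nhds (show (1 : ℝ) < 1 + ε by linarith))
    obtain ⟨t, h2, h3⟩ := (h1.and self_mem_nhdsWithin).exists
    exact ⟨t, h3, h2⟩
  refine ⟨((1 + t⁻¹) ^ p).toNNReal, fun a b => ?_⟩
  have hC : (((1 + t⁻¹) ^ p).toNNReal : ℝ≥0∞) = (1 + ENNReal.ofReal t⁻¹) ^ p := by
    rw [← ENNReal.ofReal_one, ← ENNReal.ofReal_add zero_le_one (by positivity),
      ENNReal.ofReal_rpow_of_nonneg (by positivity) hp.le]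
    rfl
  rcases le_total b (ENNReal.ofReal t * a) with h | h
  · calc (a + b) ^ p ≤ (a + ENNReal.ofReal t * a) ^ p := by gcongr
      _ = (1 + ENNReal.ofReal t) ^ p * a ^ p := by
        rw [← ENNReal.mul_rpow_of_nonneg _ _ hp.le]; ring_nf
      _ ≤ (1 + ENNReal.ofReal ε) * a ^ p := by
        gcongr
        rw [← ENNReal.ofReal_one, ← ENNReal.ofReal_add zero_le_one ht0.le,
          ← ENNReal.ofReal_add zero_le_one hε.le,
          ENNReal.ofReal_rpow_of_nonneg (by positivity) hp.le]
        exact ENNReal.ofReal_le_ofReal ht.le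
      _ ≤ _ := le_self_add
  · have ha : a ≤ ENNReal.ofReal t⁻¹ * b := by
      calc a = ENNReal.ofReal t⁻¹ * (ENNReal.ofReal t * a) := by
            rw [← mul_assoc, ← ENNReal.ofReal_mul (by positivity), inv_mul_cancel₀ ht0.ne',
              ENNReal.ofReal_one, one_mul]
        _ ≤ _ := by gcongr
    calc (a + b) ^ p ≤ (ENNReal.ofReal t⁻¹ * b + b) ^ p := by gcongr
      _ = (1 + ENNReal.ofReal t⁻¹) ^ p * b ^ p := by
        rw [← ENNReal.mul_rpow_of_nonneg _ _ hp.le]; ring_nf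
      _ = _ := by rw [hC]
      _ ≤ _ := le_add_self

end Growth

/-! ### Chains along John curves. -/

section John

variable {X : Type*} [MetricSpace X]

lemma bdryDist_le_add_dist (Ω : Set X) (x y : X) : bdryDist Ω x ≤ bdryDist Ω y + dist x y :=
  infDist_le_infDist_add_dist

lemma bdryDist_pos {Ω : Set X} (hΩ : IsOpen Ω) (hne : (frontier Ω).Nonempty) {x : X}
    (hx : x ∈ Ω) : 0 < bdryDist Ω x :=
  (isClosed_frontier.notMem_iff_infDist_pos hne).1 fun h => (hΩ.frontier_eq ▸ h).2 hx

lemma HasUnitSpeedOn.dist_le {γ : ℝ → X} {l s t : ℝ} (hγ : HasUnitSpeedOn γ (Icc 0 l))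
    (hs : s ∈ Icc 0 l) (ht : t ∈ Icc 0 l) (hst : s ≤ t) : dist (γ s) (γ t) ≤ t - s := by
  have h := hγ hs ht
  rw [NNReal.coe_one, one_mul] at h
  have h2 := eVariationOn.edist_le γ (s := Icc 0 l ∩ Icc s t) (x := s) (y := t)
    ⟨hs, le_rfl, hst⟩ ⟨ht, hst, le_rfl⟩
  rw [h, edist_dist] at h2
  exact (ENNReal.ofReal_le_ofReal_iff (by linarith)).1 h2

/-- In a bounded John domain every point is joined to the centre by a chain of points whose
distances to the boundary grow geometrically. -/
lemma IsBoundedJohnDomain.exists_chain {Ω : Set X} (hΩ : IsBoundedJohnDomain Ω)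
    (hne : (frontier Ω).Nonempty) {η : ℝ} (hη : 0 < η) :
    ∃ x₀ ∈ Ω, ∃ A q : ℝ, 1 ≤ A ∧ 1 < q ∧ ∀ x ∈ Ω, ∃ (n : ℕ) (a : ℕ → X),
      a 0 = x ∧ a n = x₀ ∧ (∀ i, a i ∈ Ω) ∧
      (∀ i < n, dist (a i) (a (i + 1)) ≤ η * bdryDist Ω (a i)) ∧
      (∀ i < n, bdryDist Ω x * q ^ i ≤ A * bdryDist Ω (a i)) ∧
      (∀ i < n, bdryDist Ω (a i) ≤ bdryDist Ω x * q ^ i) ∧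
      (∀ i < n, dist x (a i) ≤ bdryDist Ω x * q ^ i) := by
  obtain ⟨hopen, -, -, x₀, hx₀, c, hc, H⟩ := hΩ
  -- At time `t` on the curve, `t + d(x) ≤ A d(γ t)`: for `t ≤ d(x) / 2` because `d(γ t) ≥ d(x) /
  -- 2`, otherwise by the John condition.
  set A : ℝ := 3 * max c 1 with hA
  have hA1 : 3 ≤ A := by have := le_max_right c 1; linarith
  have hcA : 3 * c ≤ A := by have := le_max_left c 1; linarith
  have hηA : 0 < η / A := by positivity
  refine ⟨x₀, hx₀, A, 1 + η / A, by linarith, by linarith, fun x hx => ?_⟩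
  obtain ⟨l, γ, hl, hγ, hmaps, h0, h1, hJ⟩ := H x hx
  set d := bdryDist Ω x with hd
  set q := 1 + η / A with hq
  have hq1 : 1 < q := by linarith
  have hd0 : 0 < d := bdryDist_pos hopen hne hx
  have hqi : ∀ i : ℕ, 1 ≤ q ^ i := fun i => one_le_pow₀ hq1.le
  have hex : ∃ n : ℕ, l ≤ d * q ^ n - d := by
    obtain ⟨n, hn⟩ := pow_unbounded_of_one_lt ((l + d) / d) hq1
    refine ⟨n, ?_⟩
    rw [div_lt_iff₀ hd0] at hn
    linarith
  classical
  set n := Nat.find hex with hn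
  -- These times make `t i + d = d * q ^ i` exactly geometric; `n` is the first index at which the
  -- cap `l`, hence the centre, is reached.
  set t : ℕ → ℝ := fun i => min (d * q ^ i - d) l with ht
  have htmem : ∀ i, t i ∈ Icc 0 l := fun i =>
    ⟨le_min (by nlinarith [hqi i]) hl, min_le_right _ _⟩
  have htlt : ∀ i < n, t i = d * q ^ i - d := fun i hi =>
    min_eq_left (not_le.1 (Nat.find_min hex hi)).le
  have hdist0 : ∀ i, dist x (γ (t i)) ≤ t i := fun i => by
    have := hγ.dist_le ⟨le_rfl, hl⟩ (htmem i) (htmem i).1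
    rwa [h0, sub_zero] at this
  have hlow : ∀ i < n, d * q ^ i ≤ A * bdryDist Ω (γ (t i)) := by
    intro i hi
    have e1 := hJ _ (htmem i)
    have e2 := bdryDist_le_add_dist Ω x (γ (t i))
    have e3 := hdist0 i
    have e4 := htlt i hi
    have e5 := (htmem i).1
    rw [div_le_iff₀ hc] at e1
    rw [← hd] at e2
    have e6 : d * q ^ i = t i + d := by linarith
    rw [e6]
    have hb : 0 ≤ bdryDist Ω (γ (t i)) := infDist_nonneg
    rcases le_total (t i) (d / 2) with h | h <;> nlinarith
  refine ⟨n, fun i => γ (t i), ?_, ?_, fun i => hmaps (htmem i), ?_, hlow, ?_, ?_⟩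
  · have : t 0 = 0 := by simp [ht, hl]
    simp [this, h0]
  · have : t n = l := min_eq_right (Nat.find_spec hex)
    simp [this, h1]
  · intro i hi
    have hle : t i ≤ t (i + 1) := by
      refine min_le_min_right _ ?_
      have : q ^ i ≤ q ^ (i + 1) := pow_le_pow_right₀ hq1.le (Nat.le_succ i)
      exact sub_le_sub_right (mul_le_mul_of_nonneg_left this hd0.le) d
    refine (hγ.dist_le (htmem i) (htmem _) hle).trans ?_
    have h1 : t (i + 1) ≤ d * q ^ (i + 1) - d := min_le_left _ _
    rw [htlt i hi]
    calc t (i + 1) - (d * q ^ i - d) ≤ d * q ^ i * (η / A) := by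
          rw [pow_succ] at h1
          have : d * (q ^ i * q) = d * q ^ i + d * q ^ i * (η / A) := by rw [hq]; ring
          linarith
      _ ≤ A * bdryDist Ω (γ (t i)) * (η / A) :=
          mul_le_mul_of_nonneg_right (hlow i hi) (by positivity)
      _ = η * bdryDist Ω (γ (t i)) := by field_simp
  · intro i hi
    have e1 := bdryDist_le_add_dist Ω (γ (t i)) x
    have e2 := hdist0 i
    have e3 := htlt i hi
    rw [dist_comm] at e2
    linarith
  · intro i hi
    have e2 := hdist0 i
    have e3 := htlt i hi
    linarith

end John
lemma ENNReal.inv_le_mul_inv {a b : ℝ≥0∞} {C : ℝ≥0} (h : a ≤ C * b) (ha : a ≠ 0) :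
    b⁻¹ ≤ C * a⁻¹ := by
  rw [ENNReal.inv_le_iff_inv_le, ENNReal.mul_inv (Or.inr (ENNReal.inv_ne_top.2 ha))
    (Or.inl ENNReal.coe_ne_top), inv_inv, ← ENNReal.div_eq_inv_mul]
  exact ENNReal.div_le_of_le_mul' h

/-! ### Local means and their integrals. -/

section LocalEnergy

variable {X : Type*} [MetricSpace X]

lemma continuous_bdryDist (Ω : Set X) : Continuous (bdryDist Ω) := continuous_infDist_pt _

/-- The points of `Ω` at distance at most `θ * d(y)` from `y`. -/
def whitneyNhd (Ω : Set X) (θ : ℝ) (y : X) : Set X :=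
  Ω ∩ {z | dist z y ≤ θ * bdryDist Ω y}

/-- Moving by `e d(x)` changes the distance to the boundary by a factor at most `2`. A point of the
second ball is thus within `4 e d(x) ≤ 8 e d(y)` of `y`, whence the `8`. -/
lemma whitney_step {e : ℝ} (he : 0 < e) (he' : e ≤ 1 / 8) {Ω : Set X} {x x' y : X} (hx : 0 < bdryDist Ω x)
    (hball : ball x' (e * bdryDist Ω x') ⊆ Ω) (hxx' : dist x x' ≤ e * bdryDist Ω x)
    (hy : dist y x ≤ e * bdryDist Ω x) :
    ball x' (e * bdryDist Ω x') ⊆ whitneyNhd Ω (8 * e) y ∧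
      dist x' y ≤ 2 * bdryDist Ω x' ∧ bdryDist Ω y ≤ 2 * bdryDist Ω x' := by
  have h1 := bdryDist_le_add_dist Ω x x'
  have h2 := bdryDist_le_add_dist Ω x' x
  have h3 := bdryDist_le_add_dist Ω x y
  have h4 := bdryDist_le_add_dist Ω y x
  have h5 := dist_triangle x' x y
  rw [dist_comm x' x] at h2 h5
  rw [dist_comm x y] at h3 h5
  refine ⟨fun z hz => ⟨hball hz, ?_⟩, by nlinarith, by nlinarith⟩
  have h6 := dist_triangle z x' y
  rw [mem_ball] at hz
  change dist z y ≤ 8 * e * bdryDist Ω y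
  have h7 : bdryDist Ω x' ≤ 2 * bdryDist Ω x := by nlinarith
  have h8 : bdryDist Ω x ≤ 2 * bdryDist Ω y := by nlinarith
  nlinarith

variable [MeasurableSpace X]

/-- The integral of `k y` over a Whitney neighbourhood of `y`, divided by `μ (B(y, d(y)))`. -/
noncomputable def localMean (μ : Measure X) (Ω : Set X) (θ : ℝ) (k : X → X → ℝ≥0∞) (y : X) :
    ℝ≥0∞ :=
  (μ (ball y (bdryDist Ω y)))⁻¹ * ∫⁻ z in whitneyNhd Ω θ y, k y z ∂μ

/-- The integral over `Ω` of the local means of `k` with respect to the weight `w`. -/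
noncomputable def localEnergy (μ : Measure X) (Ω : Set X) (θ : ℝ) (w : X → ℝ≥0∞)
    (k : X → X → ℝ≥0∞) : ℝ≥0∞ :=
  ∫⁻ y in Ω, w y * localMean μ Ω θ k y ∂μ

/-- Doubling bounds `μ (B(y, d(y)))` by a multiple of the measure of the small ball, so the two
normalizations compare. -/
lemma exists_setLAverage_le_localMean {μ : Measure X} {Ω : Set X} (hμ : IsDoublingMeasure μ)
    (hpos : ∀ x ∈ Ω, 0 < bdryDist Ω x) {e : ℝ} (he : 0 < e) (θ : ℝ) :
    ∃ C : ℝ≥0, ∀ k : X → X → ℝ≥0∞, ∀ x ∈ Ω, ∀ y ∈ Ω,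
      ball x (e * bdryDist Ω x) ⊆ whitneyNhd Ω θ y →
        dist x y ≤ 2 * bdryDist Ω x → bdryDist Ω y ≤ 2 * bdryDist Ω x →
          ⨍⁻ z in ball x (e * bdryDist Ω x), k y z ∂μ ≤ C * localMean μ Ω θ k y := by
  obtain ⟨C, hC⟩ := hμ.measure_ball_le (2 / e)
  refine ⟨C, fun k x hx y hy hsub hxy hd => ?_⟩
  have hdx := hpos x hx
  have hr : 2 / e * (e * bdryDist Ω x) = 2 * bdryDist Ω x := by field_simp
  have hVB := hC x y (e * bdryDist Ω x) (bdryDist Ω y) (by positivity) (by rwa [hr]) (by rwa [hr])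
  rw [setLAverage_eq, ENNReal.div_eq_inv_mul, localMean, ← mul_assoc]
  gcongr
  exact ENNReal.inv_le_mul_inv hVB (hμ.1 y _ (hpos y hy)).1.ne'

lemma exists_le_setLAverage_add_localMean {μ : Measure X} {Ω : Set X} (hμ : IsDoublingMeasure μ)
    (hpos : ∀ x ∈ Ω, 0 < bdryDist Ω x) {e : ℝ} (he : 0 < e) (θ : ℝ) :
    ∃ C : ℝ≥0, ∀ (f : X → ℝ≥0∞) (k : X → X → ℝ≥0∞), Measurable f →
      (∀ y z, f y ≤ f z + k y z) → ∀ x ∈ Ω, ∀ y ∈ Ω,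
        ball x (e * bdryDist Ω x) ⊆ whitneyNhd Ω θ y →
        dist x y ≤ 2 * bdryDist Ω x → bdryDist Ω y ≤ 2 * bdryDist Ω x →
          f y ≤ ⨍⁻ z in ball x (e * bdryDist Ω x), f z ∂μ + C * localMean μ Ω θ k y := by
  obtain ⟨C, hC⟩ := exists_setLAverage_le_localMean hμ hpos he θ
  refine ⟨C, fun f k hf hfk x hx y hy hsub hxy hd => ?_⟩
  set B := ball x (e * bdryDist Ω x) with hB
  have hB0 := hμ.1 x (e * bdryDist Ω x) (mul_pos he (hpos x hx))
  calc f y = ⨍⁻ _ in B, f y ∂μ := (setLAverage_const hB0.1.ne' hB0.2.ne _).symm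
    _ ≤ ⨍⁻ z in B, (f z + k y z) ∂μ := laverage_mono_ae (ae_of_all _ (hfk y))
    _ = ⨍⁻ z in B, f z ∂μ + ⨍⁻ z in B, k y z ∂μ := by
      rw [setLAverage_eq, setLAverage_eq, setLAverage_eq, lintegral_add_left hf, ENNReal.add_div]
    _ ≤ _ := by
      gcongr
      exact hC k x hx y hy hsub hxy hd

variable [BorelSpace X] {μ : Measure X} {Ω : Set X}

lemma measurableSet_dist_le (Ω : Set X) (θ : ℝ) (y : X) :
    MeasurableSet {z | dist z y ≤ θ * bdryDist Ω y} :=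
  (isClosed_le (by fun_prop) continuous_const).measurableSet

lemma setLIntegral_whitneyNhd (θ : ℝ) (y : X) (g : X → ℝ≥0∞) :
    ∫⁻ z in whitneyNhd Ω θ y, g z ∂μ =
      ∫⁻ z in Ω, {z | dist z y ≤ θ * bdryDist Ω y}.indicator g z ∂μ := by
  rw [setLIntegral_indicator (measurableSet_dist_le Ω θ y), whitneyNhd, inter_comm]

lemma measurableSet_prod_dist_le [SecondCountableTopology X] (Ω : Set X) (θ : ℝ) :
    MeasurableSet {q : X × X | dist q.2 q.1 ≤ θ * bdryDist Ω q.1} :=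
  (isClosed_le (by fun_prop)
    (continuous_const.mul ((continuous_bdryDist Ω).comp continuous_fst))).measurableSet

lemma measurable_measure_ball_bdryDist [SecondCountableTopology X] [SFinite μ] (Ω : Set X) :
    Measurable fun y => μ (ball y (bdryDist Ω y)) := by
  have h : MeasurableSet {q : X × X | dist q.2 q.1 < bdryDist Ω q.1} :=
    (isOpen_lt (by fun_prop) ((continuous_bdryDist Ω).comp continuous_fst)).measurableSet
  exact measurable_measure_prodMk_left h

lemma measurable_localMean [SecondCountableTopology X] [SFinite μ] (θ : ℝ)
    {k : X → X → ℝ≥0∞} (hk : Measurable (Function.uncurry k)) :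
    Measurable (localMean μ Ω θ k) := by
  refine (measurable_measure_ball_bdryDist Ω).inv.mul ?_
  simp_rw [setLIntegral_whitneyNhd]
  exact (hk.indicator (measurableSet_prod_dist_le Ω θ)).lintegral_prod_right'

/-- By Tonelli, `y` is fixed first: the set of admissible `x` has measure at most `C V y`, which
cancels `(V y)⁻¹`, and `w x` is replaced by `w y`. -/
lemma setLIntegral_localMean_le [SecondCountableTopology X] [SigmaFinite μ]
    (hμ : IsDoublingMeasure μ) (hpos : ∀ x ∈ Ω, 0 < bdryDist Ω x) (hΩ : MeasurableSet Ω)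
    {w : X → ℝ≥0∞} (hwm : Measurable w)
    (hw : ∀ N : ℝ, ∃ C : ℝ≥0, ∀ x ∈ Ω, ∀ y ∈ Ω, dist x y ≤ N * bdryDist Ω y → w x ≤ C * w y)
    (N : ℝ) :
    ∃ C : ℝ≥0, ∀ g : X → ℝ≥0∞, Measurable g →
      ∫⁻ x in Ω, w x * ∫⁻ y in Ω, {y | dist x y ≤ N * bdryDist Ω y}.indicator
        (fun y => (μ (ball y (bdryDist Ω y)))⁻¹ * g y) y ∂μ ∂μ ≤ C * ∫⁻ y in Ω, w y * g y ∂μ := by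
  obtain ⟨C₁, hC₁⟩ := hw N
  obtain ⟨C₂, hC₂⟩ := hμ.measure_ball_le (|N| + 1)
  refine ⟨C₁ * C₂, fun g hg => ?_⟩
  set V : X → ℝ≥0∞ := fun y => μ (ball y (bdryDist Ω y)) with hV
  have hVm : Measurable V := measurable_measure_ball_bdryDist Ω
  have hS : MeasurableSet {q : X × X | dist q.1 q.2 ≤ N * bdryDist Ω q.2} :=
    (isClosed_le (by fun_prop)
      (continuous_const.mul ((continuous_bdryDist Ω).comp continuous_snd))).measurableSet
  have hSy : ∀ y, MeasurableSet {x | dist x y ≤ N * bdryDist Ω y} := measurableSet_dist_le Ω N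
  have hm : Measurable (Function.uncurry fun x y : X => w x *
      {y | dist x y ≤ N * bdryDist Ω y}.indicator (fun y => (V y)⁻¹ * g y) y) := by
    refine (hwm.comp measurable_fst).mul ?_
    exact (((hVm.inv.mul hg).comp measurable_snd).indicator hS)
  calc ∫⁻ x in Ω, w x * ∫⁻ y in Ω, {y | dist x y ≤ N * bdryDist Ω y}.indicator
        (fun y => (V y)⁻¹ * g y) y ∂μ ∂μ
      = ∫⁻ x in Ω, ∫⁻ y in Ω, w x * {y | dist x y ≤ N * bdryDist Ω y}.indicator
        (fun y => (V y)⁻¹ * g y) y ∂μ ∂μ := by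
        refine lintegral_congr fun x => (lintegral_const_mul _ ?_).symm
        refine (hVm.inv.mul hg).indicator ?_
        exact measurable_prodMk_left hS
    _ = ∫⁻ y in Ω, ∫⁻ x in Ω, w x * {y | dist x y ≤ N * bdryDist Ω y}.indicator
        (fun y => (V y)⁻¹ * g y) y ∂μ ∂μ := lintegral_lintegral_swap hm.aemeasurable
    _ ≤ ∫⁻ y in Ω, (C₁ * C₂ : ℝ≥0) * (w y * g y) ∂μ := by
        refine setLIntegral_mono' hΩ fun y hy => ?_
        calc ∫⁻ x in Ω, w x * {y | dist x y ≤ N * bdryDist Ω y}.indicator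
              (fun y => (V y)⁻¹ * g y) y ∂μ
            ≤ ∫⁻ x in Ω, {x | dist x y ≤ N * bdryDist Ω y}.indicator
              (fun _ => C₁ * w y * ((V y)⁻¹ * g y)) x ∂μ := by
              refine setLIntegral_mono' hΩ fun x hx => ?_
              by_cases h : dist x y ≤ N * bdryDist Ω y
              · simp only [indicator, mem_ofPred_eq, h, if_true]
                gcongr
                exact hC₁ x hx y hy h
              · simp [indicator, h]
          _ ≤ C₁ * w y * ((V y)⁻¹ * g y) * μ {x | dist x y ≤ N * bdryDist Ω y} := by
              rw [lintegral_indicator_const (hSy y)]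
              gcongr
              exact Measure.restrict_le_self
          _ ≤ C₁ * w y * ((V y)⁻¹ * g y) * (C₂ * V y) := by
              gcongr
              refine (measure_mono ?_).trans (hC₂ y y _ ((|N| + 1) * bdryDist Ω y) (hpos y hy)
                le_rfl ?_)
              · intro x hx
                have h1 := hpos y hy
                have h2 : dist x y ≤ N * bdryDist Ω y := hx
                have h3 := le_abs_self N
                rw [mem_ball]
                nlinarith
              · rw [dist_self]
                have h1 := hpos y hy
                positivity
          _ = (C₁ * C₂ : ℝ≥0) * (w y * g y) * ((V y)⁻¹ * V y) := by push_cast; ring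
          _ ≤ (C₁ * C₂ : ℝ≥0) * (w y * g y) * 1 := by
              gcongr
              exact ENNReal.inv_mul_le_one _
          _ = _ := mul_one _
    _ = _ := lintegral_const_mul _ (hwm.mul hg)

end LocalEnergy

/-! ### The pointwise chaining estimate. -/

section Chaining

/-- Two such indices differ by less than `N` as soon as `q ^ N > B ^ 2`. -/
lemma exists_card_geometric_le {q : ℝ} (hq : 1 < q) {B : ℝ} (hB : 0 < B) :
    ∃ N : ℕ, ∀ (d T : ℝ) (J : Finset ℕ), 0 < d → 0 < T →
      (∀ j ∈ J, T ≤ B * (d * q ^ j) ∧ d * q ^ j ≤ B * T) → J.card ≤ N := by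
  obtain ⟨N, hN⟩ := pow_unbounded_of_one_lt (B * B) hq
  refine ⟨N, fun d T J hd hT hJ => ?_⟩
  rcases J.eq_empty_or_nonempty with rfl | hne
  · simp
  have hsub : J ⊆ Finset.Ico (J.min' hne) (J.min' hne + N) := by
    intro j hj
    rw [Finset.mem_Ico]
    refine ⟨J.min'_le j hj, ?_⟩
    by_contra! hlt
    have h1 := (hJ _ (J.min'_mem hne)).1
    have h2 := (hJ j hj).2
    have h3 : q ^ (J.min' hne) * q ^ N ≤ q ^ j := by
      rw [← pow_add]
      exact pow_le_pow_right₀ hq.le hlt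
    set a := d * q ^ (J.min' hne) with ha
    have ha0 : 0 < a := by positivity
    have h4 : a * q ^ N ≤ B * T := by
      refine le_trans ?_ h2
      rw [ha, mul_assoc]
      gcongr
    have h5 : B * T ≤ B * (B * a) := by gcongr
    nlinarith
  simpa using Finset.card_le_card hsub

variable {X : Type*} [MetricSpace X] [MeasurableSpace X] [BorelSpace X]
  {μ : Measure X} {Ω : Set X}

/-- If `y` lies in the `i`-th ball, then `d(y)` is comparable with `d(x) q ^ i`; this allows
boundedly many `i` and makes `V y` comparable with the measure of the ball. -/
lemma exists_sum_setLAverage_le (hμ : IsDoublingMeasure μ) (hΩ : MeasurableSet Ω)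
    (hpos : ∀ x ∈ Ω, 0 < bdryDist Ω x) {e : ℝ} (he : 0 < e) (he' : e ≤ 1 / 8)
    (hball : ∀ x ∈ Ω, ball x (e * bdryDist Ω x) ⊆ Ω) {A q : ℝ} (hA : 1 ≤ A) (hq : 1 < q) :
    ∃ C : ℝ≥0, ∀ (g V : X → ℝ≥0∞), (∀ y, V y = μ (ball y (bdryDist Ω y))) →
      Measurable g → Measurable V → ∀ x ∈ Ω, ∀ (n : ℕ) (a : ℕ → X), (∀ i, a i ∈ Ω) →
      (∀ i < n, bdryDist Ω x * q ^ i ≤ A * bdryDist Ω (a i)) →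
      (∀ i < n, bdryDist Ω (a i) ≤ bdryDist Ω x * q ^ i) →
      (∀ i < n, dist x (a i) ≤ bdryDist Ω x * q ^ i) →
        ∑ i ∈ Finset.range n, ⨍⁻ y in ball (a i) (e * bdryDist Ω (a i)), g y ∂μ ≤
          C * ∫⁻ y in Ω, {y | dist x y ≤ 4 * A * bdryDist Ω y}.indicator
            (fun y => (V y)⁻¹ * g y) y ∂μ := by
  obtain ⟨C, hC⟩ := hμ.measure_ball_le (2 / e)
  obtain ⟨N, hN⟩ := exists_card_geometric_le hq (B := 2 * A) (by positivity)
  refine ⟨N * C, fun g V hV hg hVm x hx n a haΩ h1 h2 h3 => ?_⟩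
  set B : ℕ → Set X := fun i => ball (a i) (e * bdryDist Ω (a i)) with hB
  have hBm : ∀ i, MeasurableSet (B i) := fun i => isOpen_ball.measurableSet
  have hd : ∀ i, ∀ y ∈ B i, bdryDist Ω y ≤ 2 * bdryDist Ω (a i) ∧
      bdryDist Ω (a i) ≤ 2 * bdryDist Ω y := by
    intro i y hy
    have e1 := bdryDist_le_add_dist Ω (a i) y
    have e2 := bdryDist_le_add_dist Ω y (a i)
    have e3 := hpos _ (haΩ i)
    have e4 : dist y (a i) < e * bdryDist Ω (a i) := hy
    rw [dist_comm] at e1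
    constructor <;> nlinarith
  have hmem : ∀ i < n, ∀ y ∈ B i, dist x y ≤ 4 * A * bdryDist Ω y := by
    intro i hi y hy
    have e1 := dist_triangle_right x y (a i)
    have e2 := h1 i hi
    have e3 := h3 i hi
    have e4 : dist y (a i) < e * bdryDist Ω (a i) := hy
    have e5 := (hd i y hy).2
    have e6 := hpos _ (haΩ i)
    have e7 : A * bdryDist Ω (a i) ≤ A * (2 * bdryDist Ω y) := by gcongr
    nlinarith
  have havg : ∀ i, ⨍⁻ y in B i, g y ∂μ ≤
      ∫⁻ y in Ω, (B i).indicator (fun y => C * ((V y)⁻¹ * g y)) y ∂μ := by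
    intro i
    have e0 := hpos _ (haΩ i)
    rw [setLIntegral_indicator (hBm i), inter_eq_left.2 (hball _ (haΩ i)), setLAverage_eq,
      ENNReal.div_eq_inv_mul, ← lintegral_const_mul _ hg]
    refine setLIntegral_mono' (hBm i) fun y hy => ?_
    rw [← mul_assoc]
    gcongr
    refine ENNReal.inv_le_mul_inv ?_ ?_
    · rw [hV]
      have hr : 2 / e * (e * bdryDist Ω (a i)) = 2 * bdryDist Ω (a i) := by field_simp
      refine hC _ _ _ _ (by positivity) (by rw [hr]; exact (hd i y hy).1) ?_
      rw [hr, dist_comm]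
      have e4 : dist y (a i) < e * bdryDist Ω (a i) := hy
      nlinarith
    · rw [hV]
      exact (hμ.1 y _ (hpos y (hball _ (haΩ i) hy))).1.ne'
  have hm : Measurable fun y => (V y)⁻¹ * g y := hVm.inv.mul hg
  calc ∑ i ∈ Finset.range n, ⨍⁻ y in B i, g y ∂μ
      ≤ ∑ i ∈ Finset.range n,
          ∫⁻ y in Ω, (B i).indicator (fun y => C * ((V y)⁻¹ * g y)) y ∂μ :=
        Finset.sum_le_sum fun i _ => havg i
    _ = ∫⁻ y in Ω, ∑ i ∈ Finset.range n,
          (B i).indicator (fun y => C * ((V y)⁻¹ * g y)) y ∂μ :=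
        (lintegral_finsetSum _ fun i _ => (hm.const_mul _).indicator (hBm i)).symm
    _ ≤ ∫⁻ y in Ω, (N * C : ℝ≥0) * {y | dist x y ≤ 4 * A * bdryDist Ω y}.indicator
            (fun y => (V y)⁻¹ * g y) y ∂μ := by
        refine setLIntegral_mono' hΩ fun y hy => ?_
        classical
        set J := (Finset.range n).filter fun i => y ∈ B i with hJ
        have hJN : J.card ≤ N := by
          refine hN (bdryDist Ω x) (bdryDist Ω y) J (hpos x hx) (hpos y hy) fun j hj => ?_
          rw [hJ, Finset.mem_filter, Finset.mem_range] at hj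
          have e1 := h1 j hj.1
          have e2 := h2 j hj.1
          obtain ⟨e3, e4⟩ := hd j y hj.2
          have e5 := hpos y hy
          have e6 := hpos _ (haΩ j)
          constructor <;> nlinarith
        have hsum : ∑ i ∈ Finset.range n, (B i).indicator (fun y => C * ((V y)⁻¹ * g y)) y =
            J.card * (C * ((V y)⁻¹ * g y)) := by
          simp only [indicator_apply]
          rw [← Finset.sum_filter, Finset.sum_const, nsmul_eq_mul]
        rw [hsum]
        rcases J.eq_empty_or_nonempty with hJe | ⟨j, hj⟩
        · simp [hJe]
        · rw [hJ, Finset.mem_filter, Finset.mem_range] at hj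
          rw [indicator_of_mem (show y ∈ {y | dist x y ≤ 4 * A * bdryDist Ω y} from
            hmem j hj.1 y hj.2)]
          push_cast
          rw [mul_assoc]
          gcongr
    _ = _ := by
        refine lintegral_const_mul _ (hm.indicator ?_)
        exact (isClosed_le (by fun_prop)
          (continuous_const.mul (continuous_bdryDist Ω))).measurableSet

/-- Telescoping along the chain: each passage to the next ball costs the mean of `Λ` over the
current one, and the passage from `x` to its own ball costs `Λ x`. -/
lemma IsBoundedJohnDomain.exists_le_setLAverage_add [SecondCountableTopology X] [SFinite μ]
    (hμ : IsDoublingMeasure μ) (hΩ : IsBoundedJohnDomain Ω)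
    (hne : (frontier Ω).Nonempty) {e : ℝ} (he : 0 < e) (he' : e ≤ 1 / 8)
    (hball : ∀ x ∈ Ω, ball x (e * bdryDist Ω x) ⊆ Ω) :
    ∃ x₀ ∈ Ω, ∃ (N : ℝ) (C : ℝ≥0), ∀ (f : X → ℝ≥0∞) (k : X → X → ℝ≥0∞), Measurable f →
      Measurable (Function.uncurry k) → (∀ y z, f y ≤ f z + k y z) → ∀ x ∈ Ω,
        f x ≤ ⨍⁻ z in ball x₀ (e * bdryDist Ω x₀), f z ∂μ + C * (localMean μ Ω (8 * e) k x +
          ∫⁻ y in Ω, {y | dist x y ≤ N * bdryDist Ω y}.indicator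
            (fun y => (μ (ball y (bdryDist Ω y)))⁻¹ * localMean μ Ω (8 * e) k y) y ∂μ) := by
  have hpos : ∀ x ∈ Ω, 0 < bdryDist Ω x := fun x hx => bdryDist_pos hΩ.1 hne hx
  obtain ⟨x₀, hx₀, A, q, hA, hq, hchain⟩ := hΩ.exists_chain hne he
  obtain ⟨C₁, hC₁⟩ := exists_le_setLAverage_add_localMean hμ hpos he (8 * e)
  obtain ⟨C₂, hC₂⟩ := exists_sum_setLAverage_le hμ hΩ.1.measurableSet hpos he he' hball hA hq
  refine ⟨x₀, hx₀, 4 * A, C₁ * max C₂ 1, fun f k hf hk hfk x hx => ?_⟩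
  obtain ⟨n, a, ha0, han, haΩ, hstep, h1, h2, h3⟩ := hchain x hx
  set Λ := localMean μ Ω (8 * e) k with hΛ
  have hΛm : Measurable Λ := measurable_localMean _ hk
  set B : ℕ → Set X := fun i => ball (a i) (e * bdryDist Ω (a i)) with hB
  have hind : ∀ m ≤ n, ⨍⁻ z in B 0, f z ∂μ ≤
      ⨍⁻ z in B m, f z ∂μ + C₁ * ∑ i ∈ Finset.range m, ⨍⁻ y in B i, Λ y ∂μ := by
    intro m
    induction m with
    | zero => intro _; simp
    | succ m ih =>
      intro hm
      refine (ih (by omega)).trans ?_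
      rw [Finset.sum_range_succ, mul_add, add_comm ((C₁ : ℝ≥0∞) * _), ← add_assoc]
      gcongr
      have hBm := hμ.1 (a m) (e * bdryDist Ω (a m)) (mul_pos he (hpos _ (haΩ m)))
      -- The bound of `f y` by its mean on the next ball holds for every `y ∈ B m`, so it can be
      -- averaged over `y`.
      calc ⨍⁻ z in B m, f z ∂μ
          ≤ ⨍⁻ y in B m, (⨍⁻ z in B (m + 1), f z ∂μ + C₁ * Λ y) ∂μ := by
            refine laverage_mono_ae ?_
            filter_upwards [ae_restrict_mem (s := B m) isOpen_ball.measurableSet] with y hy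
            obtain ⟨s1, s2, s3⟩ := whitney_step he he' (hpos _ (haΩ m)) (hball _ (haΩ (m + 1)))
              (hstep m (by omega)) (mem_ball.1 hy).le
            exact hC₁ f k hf hfk _ (haΩ (m + 1)) y (hball _ (haΩ m) hy) s1 s2 s3
        _ = ⨍⁻ z in B (m + 1), f z ∂μ + C₁ * ⨍⁻ y in B m, Λ y ∂μ := by
            rw [setLAverage_eq, lintegral_add_left measurable_const, ENNReal.add_div,
              ← setLAverage_eq, ← setLAverage_eq, setLAverage_const hBm.1.ne' hBm.2.ne,
              setLAverage_eq (f := fun y => C₁ * Λ y), lintegral_const_mul _ hΛm,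
              setLAverage_eq (f := Λ), mul_div_assoc]
  have hstart : f x ≤ ⨍⁻ z in B 0, f z ∂μ + C₁ * Λ x := by
    have hx0 := hpos x hx
    obtain ⟨s1, s2, s3⟩ := whitney_step (x := x) (x' := x) (y := x) he he' hx0 (hball x hx)
      (by rw [dist_self]; positivity) (by rw [dist_self]; positivity)
    have := hC₁ f k hf hfk x hx x hx s1 s2 s3
    rwa [← ha0] at this ⊢
  have hsum := hC₂ Λ _ (fun _ => rfl) hΛm (measurable_measure_ball_bdryDist Ω) x hx n a haΩ h1 h2 h3
  set I := ∫⁻ y in Ω, {y | dist x y ≤ 4 * A * bdryDist Ω y}.indicator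
    (fun y => (μ (ball y (bdryDist Ω y)))⁻¹ * Λ y) y ∂μ with hI
  calc f x ≤ ⨍⁻ z in B 0, f z ∂μ + C₁ * Λ x := hstart
    _ ≤ ⨍⁻ z in B n, f z ∂μ + C₁ * (C₂ * I) + C₁ * Λ x := by
      gcongr
      refine (hind n le_rfl).trans ?_
      gcongr
    _ = ⨍⁻ z in B n, f z ∂μ + C₁ * (1 * Λ x + C₂ * I) := by ring
    _ ≤ ⨍⁻ z in B n, f z ∂μ + C₁ * (max C₂ 1 * Λ x + max C₂ 1 * I) := by
      gcongr
      · exact_mod_cast le_max_right C₂ 1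
      · exact le_max_left C₂ 1
    _ = _ := by
      simp only [hB, han]
      push_cast
      ring

end Chaining

/-! ### The weighted Poincaré inequality. -/

section Poincare

variable {X : Type*} [MetricSpace X] [MeasurableSpace X] [BorelSpace X]
  [SecondCountableTopology X] {μ : Measure X} [SigmaFinite μ] {Ω : Set X} {w : X → ℝ≥0∞}

lemma IsBoundedJohnDomain.exists_lintegral_le (hμ : IsDoublingMeasure μ)
    (hΩ : IsBoundedJohnDomain Ω) (hne : (frontier Ω).Nonempty) {e : ℝ} (he : 0 < e)
    (he' : e ≤ 1 / 8) (hball : ∀ x ∈ Ω, ball x (e * bdryDist Ω x) ⊆ Ω) (hwm : Measurable w)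
    (hw : ∀ N : ℝ, ∃ C : ℝ≥0, ∀ x ∈ Ω, ∀ y ∈ Ω, dist x y ≤ N * bdryDist Ω y → w x ≤ C * w y) :
    ∃ x₀ ∈ Ω, ∃ C : ℝ≥0, ∀ (f : X → ℝ≥0∞) (k : X → X → ℝ≥0∞), Measurable f →
      Measurable (Function.uncurry k) → (∀ y z, f y ≤ f z + k y z) →
        ∫⁻ x in Ω, w x * f x ∂μ ≤
          (∫⁻ x in Ω, w x ∂μ) * ⨍⁻ z in ball x₀ (e * bdryDist Ω x₀), f z ∂μ +
            C * localEnergy μ Ω (8 * e) w k := by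
  have hpos : ∀ x ∈ Ω, 0 < bdryDist Ω x := fun x hx => bdryDist_pos hΩ.1 hne hx
  have hΩm := hΩ.1.measurableSet
  obtain ⟨x₀, hx₀, N, C₁, hC₁⟩ := hΩ.exists_le_setLAverage_add hμ hne he he' hball
  obtain ⟨C₂, hC₂⟩ := setLIntegral_localMean_le hμ hpos hΩm hwm hw N
  refine ⟨x₀, hx₀, C₁ * (1 + C₂), fun f k hf hk hfk => ?_⟩
  set Λ := localMean μ Ω (8 * e) k with hΛ
  have hΛm : Measurable Λ := measurable_localMean _ hk
  have hwΛ : Measurable fun x => w x * Λ x := hwm.mul hΛm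
  set m := ⨍⁻ z in ball x₀ (e * bdryDist Ω x₀), f z ∂μ with hm
  set T : X → ℝ≥0∞ := fun x => ∫⁻ y in Ω, {y | dist x y ≤ N * bdryDist Ω y}.indicator
            (fun y => (μ (ball y (bdryDist Ω y)))⁻¹ * Λ y) y ∂μ with hT
  calc ∫⁻ x in Ω, w x * f x ∂μ
      ≤ ∫⁻ x in Ω, (w x * m + C₁ * (w x * Λ x + w x * T x)) ∂μ := by
        refine setLIntegral_mono' hΩm fun x hx => ?_
        calc w x * f x ≤ w x * (m + C₁ * (Λ x + T x)) := by
              gcongr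
              exact hC₁ f k hf hk hfk x hx
          _ = _ := by ring
    _ = (∫⁻ x in Ω, w x ∂μ) * m + C₁ * (∫⁻ x in Ω, w x * Λ x ∂μ + ∫⁻ x in Ω, w x * T x ∂μ) := by
        rw [lintegral_add_left (hwm.mul_const _), lintegral_mul_const _ hwm,
          lintegral_const_mul' _ _ ENNReal.coe_ne_top, lintegral_add_left hwΛ]
    _ ≤ (∫⁻ x in Ω, w x ∂μ) * m + C₁ * (∫⁻ x in Ω, w x * Λ x ∂μ +
          C₂ * ∫⁻ x in Ω, w x * Λ x ∂μ) := by
        gcongr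
        exact hC₂ Λ hΛm
    _ = _ := by
        rw [localEnergy]
        push_cast
        ring

/-- For `θ ≤ 1 / 2` the relation `d(z, y) ≤ θ d(y)` gives `d(y) ≤ 2 d(z)` and so `d(y, z) ≤ d(z)`;
the roles of `y` and `z` can then be exchanged in the Tonelli estimate. -/
lemma exists_localEnergy_snd_le (hμ : IsDoublingMeasure μ) (hΩ : MeasurableSet Ω)
    (hpos : ∀ x ∈ Ω, 0 < bdryDist Ω x) {θ : ℝ} (hθ : θ ≤ 1 / 2) (hwm : Measurable w)
    (hw : ∀ N : ℝ, ∃ C : ℝ≥0, ∀ x ∈ Ω, ∀ y ∈ Ω, dist x y ≤ N * bdryDist Ω y → w x ≤ C * w y) :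
    ∃ C : ℝ≥0, ∀ f : X → ℝ≥0∞, Measurable f →
      localEnergy μ Ω θ w (fun _ z => f z) ≤ C * ∫⁻ x in Ω, w x * f x ∂μ := by
  obtain ⟨C₁, hC₁⟩ := hμ.measure_ball_le 2
  obtain ⟨C₂, hC₂⟩ := setLIntegral_localMean_le hμ hpos hΩ hwm hw 1
  refine ⟨C₁ * C₂, fun f hf => ?_⟩
  have hVm := measurable_measure_ball_bdryDist (μ := μ) Ω
  set V : X → ℝ≥0∞ := fun y => μ (ball y (bdryDist Ω y)) with hV
  calc localEnergy μ Ω θ w (fun _ z => f z)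
      ≤ ∫⁻ y in Ω, C₁ * (w y * ∫⁻ z in Ω, {z | dist y z ≤ 1 * bdryDist Ω z}.indicator
        (fun z => (V z)⁻¹ * f z) z ∂μ) ∂μ := by
        refine setLIntegral_mono' hΩ fun y hy => ?_
        rw [localMean, setLIntegral_whitneyNhd, mul_left_comm (C₁ : ℝ≥0∞)]
        gcongr w y * ?_
        rw [← lintegral_const_mul _ (hf.indicator (measurableSet_dist_le Ω θ y)),
          ← lintegral_const_mul' _ _ ENNReal.coe_ne_top]
        refine setLIntegral_mono' hΩ fun z hz => ?_
        by_cases h : dist z y ≤ θ * bdryDist Ω y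
        · have h1 := bdryDist_le_add_dist Ω y z
          have h2 := bdryDist_le_add_dist Ω z y
          have h3 := hpos y hy
          have h4 := hpos z hz
          rw [dist_comm] at h1
          have h5 : dist y z ≤ 1 * bdryDist Ω z := by
            rw [dist_comm]
            nlinarith
          rw [indicator_of_mem (show z ∈ {z | dist z y ≤ θ * bdryDist Ω y} from h),
            indicator_of_mem (show z ∈ {z | dist y z ≤ 1 * bdryDist Ω z} from h5), ← mul_assoc]
          gcongr
          refine ENNReal.inv_le_mul_inv ?_ (hμ.1 z _ h4).1.ne'
          rw [dist_comm] at h5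
          exact hC₁ y z _ _ h3 (by nlinarith) (by rw [dist_comm]; nlinarith)
        · rw [indicator_of_notMem (show z ∉ {z | dist z y ≤ θ * bdryDist Ω y} from h), mul_zero]
          exact zero_le
    _ = C₁ * ∫⁻ y in Ω, w y * ∫⁻ z in Ω, {z | dist y z ≤ 1 * bdryDist Ω z}.indicator
        (fun z => (V z)⁻¹ * f z) z ∂μ ∂μ := lintegral_const_mul' _ _ ENNReal.coe_ne_top
    _ ≤ C₁ * (C₂ * ∫⁻ x in Ω, w x * f x ∂μ) := by
        gcongr
        exact hC₂ f hf
    _ = _ := by push_cast; ring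

lemma localEnergy_add (θ : ℝ) (hwm : Measurable w) {k₁ k₂ : X → X → ℝ≥0∞} {c₁ c₂ : ℝ≥0∞}
    (hc₁ : c₁ ≠ ∞) (hc₂ : c₂ ≠ ∞) (hk₁ : Measurable (Function.uncurry k₁)) :
    localEnergy μ Ω θ w (fun y z => c₁ * k₁ y z + c₂ * k₂ y z) =
      c₁ * localEnergy μ Ω θ w k₁ + c₂ * localEnergy μ Ω θ w k₂ := by
  have hm : Measurable fun y => c₁ * (w y * localMean μ Ω θ k₁ y) :=
    (hwm.mul (measurable_localMean θ hk₁)).const_mul c₁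
  simp only [localEnergy]
  rw [← lintegral_const_mul' _ _ hc₁, ← lintegral_const_mul' _ _ hc₂, ← lintegral_add_left hm]
  refine lintegral_congr fun y => ?_
  simp only [localMean]
  have hmy : Measurable fun z => c₁ * k₁ y z := (hk₁.comp measurable_prodMk_left).const_mul c₁
  rw [lintegral_add_left hmy,
    lintegral_const_mul' _ _ hc₁, lintegral_const_mul' _ _ hc₂]
  ring

/-- Selects the point whose value of `u` becomes the constant `a`: somewhere in the central ball the
local mean does not exceed its average, and there `w` is bounded below by a multiple of `w x₀`. -/
lemma exists_setLAverage_le_localEnergy (hμ : IsDoublingMeasure μ)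
    (hpos : ∀ x ∈ Ω, 0 < bdryDist Ω x) {e : ℝ} (he : 0 < e) (he' : e ≤ 1 / 8)
    (hball : ∀ x ∈ Ω, ball x (e * bdryDist Ω x) ⊆ Ω)
    (hw0 : ∀ x ∈ Ω, w x ≠ 0) (hwtop : ∀ x, w x ≠ ∞)
    (hw : ∀ N : ℝ, ∃ C : ℝ≥0, ∀ x ∈ Ω, ∀ y ∈ Ω, dist x y ≤ N * bdryDist Ω y → w x ≤ C * w y)
    {x₀ : X} (hx₀ : x₀ ∈ Ω) :
    ∃ C : ℝ≥0∞, C ≠ ∞ ∧ ∀ k : X → X → ℝ≥0∞, Measurable (Function.uncurry k) → ∃ y,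
      ⨍⁻ z in ball x₀ (e * bdryDist Ω x₀), k y z ∂μ ≤ C * localEnergy μ Ω (8 * e) w k := by
  obtain ⟨C₁, hC₁⟩ := exists_setLAverage_le_localMean hμ hpos he (8 * e)
  obtain ⟨C₂, hC₂⟩ := hw 1
  set B := ball x₀ (e * bdryDist Ω x₀) with hB
  have hd := hpos x₀ hx₀
  have hB0 := hμ.1 x₀ (e * bdryDist Ω x₀) (by positivity)
  have hBm : MeasurableSet B := isOpen_ball.measurableSet
  refine ⟨C₁ * ((μ B)⁻¹ * (C₂ * (w x₀)⁻¹)), ?_, fun k hk => ?_⟩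
  · exact ENNReal.mul_ne_top ENNReal.coe_ne_top (ENNReal.mul_ne_top
      (ENNReal.inv_ne_top.2 hB0.1.ne') (ENNReal.mul_ne_top ENNReal.coe_ne_top
        (ENNReal.inv_ne_top.2 (hw0 x₀ hx₀))))
  have hΛm : Measurable (localMean μ Ω (8 * e) k) := measurable_localMean _ hk
  obtain ⟨y, hyB, hy⟩ := exists_le_setLAverage hB0.1.ne' hB0.2.ne hΛm.aemeasurable
  refine ⟨y, ?_⟩
  obtain ⟨s1, s2, s3⟩ := whitney_step he he' hd (hball x₀ hx₀)
    (by rw [dist_self]; positivity) (mem_ball.1 hyB).le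
  refine (hC₁ k x₀ hx₀ y (hball _ hx₀ hyB) s1 s2 s3).trans ?_
  rw [mul_assoc]
  gcongr
  refine hy.trans ?_
  rw [setLAverage_eq, ENNReal.div_eq_inv_mul, mul_assoc]
  gcongr
  calc ∫⁻ z in B, localMean μ Ω (8 * e) k z ∂μ
      ≤ ∫⁻ z in B, C₂ * (w x₀)⁻¹ * (w z * localMean μ Ω (8 * e) k z) ∂μ := by
        refine setLIntegral_mono' hBm fun z hz => ?_
        have h1 : w x₀ ≤ C₂ * w z := by
          refine hC₂ x₀ hx₀ z (hball _ hx₀ hz) ?_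
          have h2 := bdryDist_le_add_dist Ω x₀ z
          have h3 : dist z x₀ < e * bdryDist Ω x₀ := hz
          rw [dist_comm] at h3
          nlinarith
        calc localMean μ Ω (8 * e) k z = (w x₀)⁻¹ * w x₀ * localMean μ Ω (8 * e) k z := by
              rw [ENNReal.inv_mul_cancel (hw0 x₀ hx₀) (hwtop x₀), one_mul]
          _ ≤ (w x₀)⁻¹ * (C₂ * w z) * localMean μ Ω (8 * e) k z := by gcongr
          _ = _ := by ring
    _ = C₂ * (w x₀)⁻¹ * ∫⁻ z in B, w z * localMean μ Ω (8 * e) k z ∂μ :=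
        lintegral_const_mul' _ _
          (ENNReal.mul_ne_top ENNReal.coe_ne_top (ENNReal.inv_ne_top.2 (hw0 x₀ hx₀)))
    _ ≤ _ := by
        gcongr
        exact lintegral_mono_set (hball _ hx₀)

/-- The map `t ↦ min |t - a| M` is 1-Lipschitz, so the truncated power satisfies the hypothesis `f y
≤ f z + k y z` of the chaining estimate. -/
lemma min_enorm_sub_rpow_le {p ε : ℝ} (hp : 0 < p) {C : ℝ≥0}
    (hC : ∀ a b : ℝ≥0∞, (a + b) ^ p ≤ (1 + ENNReal.ofReal ε) * a ^ p + C * b ^ p)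
    (s t a : ℝ) (M : ℝ≥0∞) :
    min ‖s - a‖ₑ M ^ p ≤ min ‖t - a‖ₑ M ^ p +
      (ENNReal.ofReal ε * min ‖t - a‖ₑ M ^ p + C * ‖t - s‖ₑ ^ p) := by
  have h : min ‖s - a‖ₑ M ≤ min ‖t - a‖ₑ M + ‖t - s‖ₑ := by
    rcases le_total ‖t - a‖ₑ M with h | h
    · rw [min_eq_left h]
      refine (min_le_left _ _).trans ?_
      have h2 : s - a = (t - a) - (t - s) := by ring
      rw [h2]
      exact enorm_sub_le
    · rw [min_eq_right h]
      exact (min_le_right _ _).trans le_self_add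
  calc min ‖s - a‖ₑ M ^ p ≤ (min ‖t - a‖ₑ M + ‖t - s‖ₑ) ^ p := by gcongr
    _ ≤ _ := hC _ _
    _ = _ := by ring

theorem IsBoundedJohnDomain.exists_weighted_poincare (hμ : IsDoublingMeasure μ)
    (hΩ : IsBoundedJohnDomain Ω) (hne : (frontier Ω).Nonempty) {e : ℝ} (he : 0 < e)
    (he' : e ≤ 1 / 16) (hball : ∀ x ∈ Ω, ball x (e * bdryDist Ω x) ⊆ Ω) (hwm : Measurable w)
    (hw0 : ∀ x ∈ Ω, w x ≠ 0) (hwtop : ∀ x, w x ≠ ∞) (hwint : ∫⁻ x in Ω, w x ∂μ ≠ ∞)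
    (hw : ∀ N : ℝ, ∃ C : ℝ≥0, ∀ x ∈ Ω, ∀ y ∈ Ω, dist x y ≤ N * bdryDist Ω y → w x ≤ C * w y)
    {p : ℝ} (hp : 0 < p) :
    ∃ C : ℝ≥0∞, C ≠ ∞ ∧ ∀ u : X → ℝ, Measurable u → ∃ a : ℝ,
      ∫⁻ x in Ω, w x * ‖u x - a‖ₑ ^ p ∂μ ≤
        C * localEnergy μ Ω (8 * e) w (fun y z => ‖u z - u y‖ₑ ^ p) := by
  have hpos : ∀ x ∈ Ω, 0 < bdryDist Ω x := fun x hx => bdryDist_pos hΩ.1 hne hx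
  have hΩm := hΩ.1.measurableSet
  have he8 : e ≤ 1 / 8 := he'.trans (by norm_num)
  obtain ⟨x₀, hx₀, C₁, hC₁⟩ := hΩ.exists_lintegral_le hμ hne he he8 hball hwm hw
  obtain ⟨C₂, hC₂⟩ := exists_localEnergy_snd_le hμ hΩm hpos
    (show 8 * e ≤ 1 / 2 by linarith) hwm hw
  obtain ⟨C₃, hC₃top, hC₃⟩ := exists_setLAverage_le_localEnergy hμ hpos he he8 hball hw0 hwtop hw
    hx₀
  -- Chosen so that the `ε` part of the energy is at most half of the left-hand side.
  set ε : ℝ := (2 * (C₁ * C₂ + 1))⁻¹ with hε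
  have hε0 : 0 < ε := by positivity
  have hεC : (C₁ : ℝ≥0∞) * (ENNReal.ofReal ε * C₂) ≤ 2⁻¹ := by
    have h1 : (C₁ : ℝ) * (ε * C₂) ≤ 2⁻¹ := by
      have h2 : ε * (2 * ((C₁ : ℝ) * C₂ + 1)) = 1 := inv_mul_cancel₀ (by positivity)
      nlinarith
    have h3 := ENNReal.ofReal_le_ofReal h1
    rwa [ENNReal.ofReal_mul C₁.coe_nonneg, ENNReal.ofReal_mul hε0.le, ENNReal.ofReal_coe_nnreal,
      ENNReal.ofReal_coe_nnreal, ENNReal.ofReal_inv_of_pos two_pos, ENNReal.ofReal_ofNat] at h3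
  obtain ⟨C₄, hC₄⟩ := exists_add_rpow_le hp hε0
  set W := ∫⁻ x in Ω, w x ∂μ with hW
  refine ⟨2 * (W * C₃ + C₁ * C₄), ?_, fun u hu => ?_⟩
  · exact ENNReal.mul_ne_top ENNReal.ofNat_ne_top (ENNReal.add_ne_top.2
      ⟨ENNReal.mul_ne_top hwint hC₃top, ENNReal.mul_ne_top ENNReal.coe_ne_top ENNReal.coe_ne_top⟩)
  have hkm : Measurable (Function.uncurry fun y z => ‖u z - u y‖ₑ ^ p) := by
    simp only [Function.uncurry_def]
    fun_prop
  set E := localEnergy μ Ω (8 * e) w (fun y z => ‖u z - u y‖ₑ ^ p) with hE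
  obtain ⟨y₀, hy₀⟩ := hC₃ _ hkm
  refine ⟨u y₀, ?_⟩
  set g : X → ℝ≥0∞ := fun x => ‖u x - u y₀‖ₑ with hg
  have hgm : Measurable g := by fun_prop
  have htrunc : ∀ n : ℕ, ∫⁻ x in Ω, w x * min (g x) n ^ p ∂μ ≤
      2 * (W * C₃ + C₁ * C₄) * E := by
    intro n
    set f : X → ℝ≥0∞ := fun x => min (g x) n ^ p with hf
    have hfm : Measurable f := by fun_prop
    have hf2 : Measurable (Function.uncurry fun _ z : X => f z) := hfm.comp measurable_snd
    set S := ∫⁻ x in Ω, w x * f x ∂μ with hS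
    -- Only the truncation at `n` and the finite total weight give finiteness, without which `2⁻¹ *
    -- S` could not be cancelled.
    have hSfin : S ≠ ∞ := by
      have h1 : S ≤ W * (n : ℝ≥0∞) ^ p := by
        rw [hW, ← lintegral_mul_const _ hwm]
        refine lintegral_mono fun x => ?_
        simp only [hf]
        gcongr
        exact min_le_right _ _
      exact ne_top_of_le_ne_top (ENNReal.mul_ne_top hwint
        (ENNReal.rpow_ne_top_of_nonneg hp.le (ENNReal.natCast_ne_top n))) h1
    have hmain := hC₁ f (fun y z => ENNReal.ofReal ε * f z + C₄ * ‖u z - u y‖ₑ ^ p) hfm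
      ((hf2.const_mul _).add (hkm.const_mul _))
      (fun y z => min_enorm_sub_rpow_le hp hC₄ (u y) (u z) (u y₀) n)
    rw [localEnergy_add (8 * e) hwm ENNReal.ofReal_ne_top ENNReal.coe_ne_top hf2] at hmain
    have hS2 : S ≤ (W * C₃ + C₁ * C₄) * E + 2⁻¹ * S := by
      calc S ≤ W * (C₃ * E) + C₁ * (ENNReal.ofReal ε * (C₂ * S) + C₄ * E) := by
            refine hmain.trans ?_
            gcongr
            · refine le_trans (laverage_mono_ae (ae_of_all _ fun z => ?_)) hy₀
              simp only [hf]
              gcongr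
              exact min_le_left _ _
            · exact hC₂ f hfm
        _ = (W * C₃ + C₁ * C₄) * E + C₁ * (ENNReal.ofReal ε * C₂) * S := by ring
        _ ≤ _ := by gcongr
    have hhalf : (2⁻¹ : ℝ≥0∞) * S ≠ ∞ := ENNReal.mul_ne_top (by simp) hSfin
    have hsplit : S = 2⁻¹ * S + 2⁻¹ * S := by
      rw [← add_mul, ENNReal.inv_two_add_inv_two, one_mul]
    have h3 : 2⁻¹ * S ≤ (W * C₃ + C₁ * C₄) * E := by
      refine (ENNReal.add_le_add_iff_right hhalf).1 ?_
      rwa [← hsplit]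
    calc S = 2 * (2⁻¹ * S) := by
          rw [← mul_assoc, ENNReal.mul_inv_cancel two_ne_zero ENNReal.ofNat_ne_top, one_mul]
      _ ≤ 2 * ((W * C₃ + C₁ * C₄) * E) := by gcongr
      _ = _ := by ring
  calc ∫⁻ x in Ω, w x * g x ^ p ∂μ
      ≤ ∫⁻ x in Ω, ⨆ n : ℕ, w x * min (g x) n ^ p ∂μ := by
        refine lintegral_mono fun x => ?_
        obtain ⟨n, hn⟩ := ENNReal.exists_nat_gt (show g x ≠ ∞ from enorm_ne_top)
        refine le_iSup_of_le n ?_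
        rw [min_eq_left hn.le]
    _ = ⨆ n : ℕ, ∫⁻ x in Ω, w x * min (g x) n ^ p ∂μ := by
        refine lintegral_iSup (fun n => by fun_prop) fun m n hmn x => ?_
        dsimp only
        gcongr
    _ ≤ _ := iSup_le htrunc

end Poincare

/-! ### The weight `φ(d_F)` and the fractional seminorm. -/

section Seminorm

variable {X : Type*} [MetricSpace X]

/-- The weight `φ(d_F)`, extended by `0` to `F`. -/
noncomputable def distWeight (F : Set X) (φ : ℝ → ℝ) (x : X) : ℝ≥0∞ :=
  ENNReal.ofReal ((Ioi 0).indicator φ (infDist x F))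

variable {Ω F : Set X} {φ : ℝ → ℝ}

lemma distWeight_eq {x : X} (hx : 0 < infDist x F) :
    distWeight F φ x = ENNReal.ofReal (φ (infDist x F)) := by
  rw [distWeight, indicator_of_mem (mem_Ioi.2 hx)]

lemma bdryDist_le_infDist (hF0 : F.Nonempty) (hF : F ⊆ frontier Ω) (x : X) :
    bdryDist Ω x ≤ infDist x F :=
  infDist_le_infDist_of_subset hF hF0

/-- Since `d ≤ d_F`, one has `d_F(x) ≤ (1 + |N|) d_F(y)`. Only this one-sided comparison is
available, as `x` may lie far closer to `F`; monotonicity of `φ` makes it enough. -/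
lemma exists_distWeight_le (hpos : ∀ t : ℝ, 0 < t → 0 < φ t)
    (hmono : MonotoneOn φ (Ioi 0)) (hgrowth : ∃ K : ℝ, ∀ t : ℝ, 0 < t → φ (2 * t) ≤ K * φ t)
    (hF0 : F.Nonempty) (hF : F ⊆ frontier Ω) (hd : ∀ x ∈ Ω, 0 < bdryDist Ω x) (N : ℝ) :
    ∃ C : ℝ≥0, ∀ x ∈ Ω, ∀ y ∈ Ω, dist x y ≤ N * bdryDist Ω y →
      distWeight F φ x ≤ C * distWeight F φ y := by
  obtain ⟨C, hC0, hC⟩ := exists_le_mul_of_doubling hpos hmono hgrowth (1 + |N|)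
  refine ⟨C.toNNReal, fun x hx y hy hxy => ?_⟩
  have hx0 := (hd x hx).trans_le (bdryDist_le_infDist hF0 hF x)
  have hle := bdryDist_le_infDist hF0 hF y
  have hy0 := (hd y hy).trans_le hle
  rw [distWeight_eq hx0, distWeight_eq hy0]
  change _ ≤ ENNReal.ofReal C * _
  rw [← ENNReal.ofReal_mul hC0.le]
  refine ENNReal.ofReal_le_ofReal (hC _ _ hx0 hy0 ?_)
  have h1 : infDist x F ≤ infDist y F + dist x y := infDist_le_infDist_add_dist
  have h2 : N * bdryDist Ω y ≤ |N| * infDist y F :=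
    mul_le_mul (le_abs_self N) hle (hd y hy).le (abs_nonneg N)
  linarith

variable [MeasurableSpace X] {μ : Measure X}

lemma truncSeminorm_congr_ae (s p τ : ℝ) (v : X → X → ℝ) {u u' : X → ℝ}
    (h : u =ᵐ[μ.restrict Ω] u') :
    truncSeminorm μ Ω s p τ v u = truncSeminorm μ Ω s p τ v u' := by
  rw [truncSeminorm, truncSeminorm]
  congr 1
  refine lintegral_congr_ae ?_
  filter_upwards [h] with y hy
  refine lintegral_congr_ae ?_
  filter_upwards [ae_restrict_of_ae_restrict_of_subset inter_subset_left h] with z hz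
  rw [hy, hz]

/-- Cutting `φ` off to `0` on `(-∞, 0]` makes it monotone on the whole line, hence Borel. -/
lemma measurable_distWeight [BorelSpace X] (hpos : ∀ t : ℝ, 0 < t → 0 < φ t)
    (hmono : MonotoneOn φ (Ioi 0)) : Measurable (distWeight F φ) := by
  have h : Monotone ((Ioi 0).indicator φ) := by
    intro s t hst
    rcases lt_or_ge 0 s with hs | hs
    · have ht := hs.trans_le hst
      rw [indicator_of_mem (mem_Ioi.2 hs), indicator_of_mem (mem_Ioi.2 ht)]
      exact hmono hs ht hst
    · rw [indicator_of_notMem (notMem_Ioi.2 hs)]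
      exact indicator_nonneg (fun t ht => (hpos t ht).le) t
  exact (h.measurable.comp (measurable_infDist)).ennreal_ofReal

lemma lintegral_distWeight_ne_top (hμ : IsDoublingMeasure μ) (hb : Bornology.IsBounded Ω)
    (hpos : ∀ t : ℝ, 0 < t → 0 < φ t) (hmono : MonotoneOn φ (Ioi 0)) (hF0 : F.Nonempty) :
    ∫⁻ x in Ω, distWeight F φ x ∂μ ≠ ∞ := by
  obtain ⟨f₀, hf₀⟩ := hF0
  obtain ⟨R, hR⟩ := hb.subset_ball_lt 0 f₀
  have hfin : μ Ω < ∞ := (measure_mono hR.2).trans_lt (hμ.1 f₀ R hR.1).2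
  have hle : ∀ x ∈ Ω, distWeight F φ x ≤ ENNReal.ofReal (φ R) := by
    intro x hx
    refine ENNReal.ofReal_le_ofReal ?_
    by_cases h : 0 < infDist x F
    · rw [indicator_of_mem (mem_Ioi.2 h)]
      exact hmono h hR.1 ((infDist_le_dist_of_mem hf₀).trans (mem_ball.1 (hR.2 hx)).le)
    · rw [indicator_of_notMem (mem_Ioi.not.2 h)]
      exact (hpos R hR.1).le
  refine ne_top_of_le_ne_top (ENNReal.mul_ne_top (ENNReal.ofReal_ne_top (r := φ R)) hfin.ne) ?_
  rw [← setLIntegral_const]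
  exact setLIntegral_mono measurable_const hle

lemma eLpNorm_weightedMeasure [BorelSpace X] (hpos : ∀ t : ℝ, 0 < t → 0 < φ t)
    (hmono : MonotoneOn φ (Ioi 0)) (hΩ : MeasurableSet Ω) (hF0 : ∀ x ∈ Ω, 0 < infDist x F)
    {p : ℝ} (hp : 0 < p) {u : X → ℝ} (hu : Measurable u) :
    eLpNorm u (ENNReal.ofReal p) (weightedMeasure μ Ω F φ) =
      (∫⁻ x in Ω, distWeight F φ x * ‖u x‖ₑ ^ p ∂μ) ^ (1 / p) := by
  have h : weightedMeasure μ Ω F φ = (μ.restrict Ω).withDensity (distWeight F φ) := by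
    refine withDensity_congr_ae ?_
    filter_upwards [ae_restrict_mem hΩ] with x hx
    rw [distWeight_eq (hF0 x hx)]
  rw [eLpNorm_eq_lintegral_rpow_enorm_toReal (by simpa using hp) ENNReal.ofReal_ne_top,
    ENNReal.toReal_ofReal hp.le, h, lintegral_withDensity_eq_lintegral_mul _
      (measurable_distWeight hpos hmono) (by fun_prop)]
  rfl

/-- For `d(z, y) ≤ θ d(y)` the ball `B(z, d(z, y))` has measure at most `C μ(B(y, d(y)))`, `d(z, y)
^ (s p) ≤ d(y) ^ (s p)`, and both entries of the minimum `v z y` are bounded below by a multiple of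
`d(y) ^ (s p) φ(d_F(y))`. -/
lemma exists_localEnergy_le_truncSeminorm (hμ : IsDoublingMeasure μ)
    (hΩ : MeasurableSet Ω) (hd : ∀ x ∈ Ω, 0 < bdryDist Ω x)
    (hpos : ∀ t : ℝ, 0 < t → 0 < φ t) (hmono : MonotoneOn φ (Ioi 0))
    (hgrowth : ∃ K : ℝ, ∀ t : ℝ, 0 < t → φ (2 * t) ≤ K * φ t)
    (hF0 : F.Nonempty) (hF : F ⊆ frontier Ω) [BorelSpace X]
    {s p τ θ : ℝ} (hs : 0 ≤ s) (hp : 0 < p) (hθ : θ ≤ 1 / 2) (hθτ : θ ≤ τ) :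
    ∃ C : ℝ≥0, ∀ u : X → ℝ,
      localEnergy μ Ω θ (distWeight F φ) (fun y z => ‖u z - u y‖ₑ ^ p) ≤
        C * truncSeminorm μ Ω s p τ (minWeight Ω F φ (s * p)) u ^ p := by
  obtain ⟨C₂, hC₂0, hC₂⟩ := exists_le_mul_of_doubling hpos hmono hgrowth 3
  have hsp : 0 ≤ s * p := by positivity
  set C₃ : ℝ := max 1 (2 ^ (s * p) * C₂) with hC₃
  have hC₃0 : 0 < C₃ := lt_max_of_lt_left one_pos
  have hdF : ∀ x ∈ Ω, 0 < infDist x F := fun x hx =>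
    (hd x hx).trans_le (bdryDist_le_infDist hF0 hF x)
  obtain ⟨C₄, hC₄⟩ := hμ.measure_ball_le 2
  refine ⟨C₄ * C₃.toNNReal, fun u => ?_⟩
  set v := minWeight Ω F φ (s * p) with hv
  set w := distWeight F φ with hw
  have hweight : ∀ y ∈ Ω, ∀ z ∈ Ω, dist z y ≤ θ * bdryDist Ω y →
      bdryDist Ω y ^ (s * p) * φ (infDist y F) ≤ C₃ * v z y := by
    intro y hy z hz hzy
    have hy0 := hd y hy
    have hz0 := hd z hz
    have hd1 : bdryDist Ω y ≤ 2 * bdryDist Ω z := by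
      have := bdryDist_le_add_dist Ω y z
      rw [dist_comm] at this
      nlinarith
    have hd2 : infDist y F ≤ 3 * infDist z F := by
      have h1 : infDist y F ≤ infDist z F + dist y z := infDist_le_infDist_add_dist
      have h2 := bdryDist_le_infDist hF0 hF z
      rw [dist_comm] at h1
      nlinarith
    have hφy := hpos _ (hdF y hy)
    have hφz := hpos _ (hdF z hz)
    rw [hv, minWeight, mul_min_of_nonneg _ _ hC₃0.le]
    refine le_min ?_ ?_
    · calc bdryDist Ω y ^ (s * p) * φ (infDist y F)
          ≤ (2 * bdryDist Ω z) ^ (s * p) * (C₂ * φ (infDist z F)) := by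
            gcongr
            exact hC₂ _ _ (hdF y hy) (hdF z hz) hd2
        _ = 2 ^ (s * p) * C₂ * (bdryDist Ω z ^ (s * p) * φ (infDist z F)) := by
            rw [Real.mul_rpow two_pos.le hz0.le]
            ring
        _ ≤ _ := by
            gcongr
            exact le_max_right _ _
    · exact le_mul_of_one_le_left (by positivity) (le_max_left _ _)
  have hpt : ∀ y ∈ Ω, ∀ z ∈ whitneyNhd Ω θ y,
      w y * (μ (ball y (bdryDist Ω y)))⁻¹ * ‖u z - u y‖ₑ ^ p ≤
        (C₄ * C₃.toNNReal : ℝ≥0) * (ENNReal.ofReal (|u z - u y| ^ p * v z y) /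
          (μ (ball z (dist z y)) * ENNReal.ofReal (dist z y ^ (s * p)))) := by
    rintro y hy z ⟨hz, hzy⟩
    rcases eq_or_ne z y with rfl | hne
    · simp [hp]
    have hzy : dist z y ≤ θ * bdryDist Ω y := hzy
    have hr : 0 < dist z y := dist_pos.2 hne
    have hy0 := hd y hy
    have hry : dist z y ≤ bdryDist Ω y := by nlinarith
    set r := dist z y with hrdef
    set V := μ (ball y (bdryDist Ω y)) with hV
    have hV0 := hμ.1 y _ hy0
    have hBr := hμ.1 z r hr
    have hBV : μ (ball z r) ≤ C₄ * V :=
      hC₄ y z _ r hy0 (by linarith) (by rw [dist_comm]; linarith)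
    have hrs : 0 < r ^ (s * p) := Real.rpow_pos_of_pos hr _
    have hdiff : ‖u z - u y‖ₑ ^ p = ENNReal.ofReal (|u z - u y| ^ p) := by
      rw [← ofReal_norm, Real.norm_eq_abs,
        ENNReal.ofReal_rpow_of_nonneg (abs_nonneg _) hp.le]
    rw [← mul_div_assoc, ENNReal.le_div_iff_mul_le
      (Or.inl (mul_ne_zero hBr.1.ne' (ENNReal.ofReal_pos.2 hrs).ne'))
      (Or.inl (ENNReal.mul_ne_top hBr.2.ne ENNReal.ofReal_ne_top))]
    calc w y * V⁻¹ * ‖u z - u y‖ₑ ^ p * (μ (ball z r) * ENNReal.ofReal (r ^ (s * p)))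
        ≤ w y * V⁻¹ * ‖u z - u y‖ₑ ^ p *
            ((C₄ * V) * ENNReal.ofReal (bdryDist Ω y ^ (s * p))) := by
          gcongr
      _ = C₄ * (ENNReal.ofReal (bdryDist Ω y ^ (s * p)) * w y * ‖u z - u y‖ₑ ^ p) *
            (V⁻¹ * V) := by ring
      _ = C₄ * ENNReal.ofReal (|u z - u y| ^ p *
            (bdryDist Ω y ^ (s * p) * φ (infDist y F))) := by
          rw [ENNReal.inv_mul_cancel hV0.1.ne' hV0.2.ne, mul_one, hw, distWeight_eq (hdF y hy),
            hdiff, ← ENNReal.ofReal_mul (by positivity), mul_comm,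
            ← ENNReal.ofReal_mul (mul_nonneg (by positivity) (hpos _ (hdF y hy)).le),
            mul_comm (|u z - u y| ^ p), mul_comm]
      _ ≤ C₄ * ENNReal.ofReal (C₃ * (|u z - u y| ^ p * v z y)) := by
          gcongr C₄ * ENNReal.ofReal ?_
          calc |u z - u y| ^ p * (bdryDist Ω y ^ (s * p) * φ (infDist y F))
              ≤ |u z - u y| ^ p * (C₃ * v z y) := by
                gcongr |u z - u y| ^ p * ?_
                exact hweight y hy z hz hzy
            _ = _ := by ring
      _ = _ := by
          rw [ENNReal.ofReal_mul hC₃0.le, ENNReal.coe_mul, mul_assoc]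
          rfl
  have hpow : truncSeminorm μ Ω s p τ v u ^ p = ∫⁻ y in Ω,
      ∫⁻ z in Ω ∩ {z | dist z y ≤ τ * bdryDist Ω y}, ENNReal.ofReal (|u z - u y| ^ p * v z y) /
        (μ (ball z (dist z y)) * ENNReal.ofReal (dist z y ^ (s * p))) ∂μ ∂μ := by
    rw [truncSeminorm, ← ENNReal.rpow_mul, one_div, inv_mul_cancel₀ hp.ne', ENNReal.rpow_one]
  rw [hpow, localEnergy, ← lintegral_const_mul' _ _ ENNReal.coe_ne_top]
  refine setLIntegral_mono' hΩ fun y hy => ?_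
  have hfin : w y * (μ (ball y (bdryDist Ω y)))⁻¹ ≠ ∞ :=
    ENNReal.mul_ne_top ENNReal.ofReal_ne_top (ENNReal.inv_ne_top.2 (hμ.1 y _ (hd y hy)).1.ne')
  rw [localMean, ← mul_assoc, ← lintegral_const_mul' _ _ hfin,
    ← lintegral_const_mul' _ _ ENNReal.coe_ne_top]
  refine (setLIntegral_mono' (hΩ.inter (measurableSet_dist_le Ω θ y)) (hpt y hy)).trans ?_
  refine lintegral_mono_set (inter_subset_inter_right _ fun z hz => ?_)
  exact le_trans (show dist z y ≤ θ * bdryDist Ω y from hz)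
    (mul_le_mul_of_nonneg_right hθτ (hd y hy).le)

end Seminorm

/-! ### The fractional Poincaré inequality. -/

theorem theorem3p4 {X : Type*} [MetricSpace X] [MeasurableSpace X] [BorelSpace X]
    (μ : Measure X) (hμ : IsDoublingMeasure μ)
    (δ : ℝ) (hδ : IsReverseDoublingMeasure μ δ)
    (s τ p : ℝ) (hs : 0 < s) (hsδ : s ≤ δ) (hτ : 0 < τ) (hτ1 : τ < 1) (hp : 1 ≤ p)
    (Ω : Set X) (hΩ : IsBoundedJohnDomain Ω)
    (hball : ∃ κ : ℝ, 0 < κ ∧ ∀ x ∈ Ω, ball x (κ * bdryDist Ω x) ⊆ Ω)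
    (F : Set X) (hF : IsCompact F) (hF0 : F.Nonempty) (hFΩ : F ⊆ frontier Ω)
    (φ : ℝ → ℝ) (hφpos : ∀ t : ℝ, 0 < t → 0 < φ t) (hφmono : MonotoneOn φ (Ioi 0))
    (hφgrowth : ∃ K : ℝ, ∀ t : ℝ, 0 < t → φ (2 * t) ≤ K * φ t)
    (hφloc : LocallyIntegrableOn (fun x => φ (infDist x F)) Ω μ) :
    ∃ C : ℝ≥0, ∀ u : X → ℝ, AEStronglyMeasurable u (μ.restrict Ω) →
      ⨅ a : ℝ, eLpNorm (fun x => u x - a) (ENNReal.ofReal p) (weightedMeasure μ Ω F φ) ≤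
        C * truncSeminorm μ Ω s p τ (minWeight Ω F φ (s * p)) u := by
  obtain ⟨κ, hκ, hκΩ⟩ := hball
  have hp0 : 0 < p := by linarith
  have := hμ.sigmaFinite
  have := hμ.secondCountableTopology
  have hΩo : IsOpen Ω := hΩ.1
  have hne : (frontier Ω).Nonempty := hF0.mono hFΩ
  have hd : ∀ x ∈ Ω, 0 < bdryDist Ω x := fun x hx => bdryDist_pos hΩo hne hx
  have hdF : ∀ x ∈ Ω, 0 < infDist x F := fun x hx =>
    (hd x hx).trans_le (bdryDist_le_infDist hF0 hFΩ x)
  -- `κ` keeps the balls inside `Ω`, `τ` gives `8 * e ≤ τ`, and `τ < 1` gives `e ≤ 1 / 16`.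
  set e : ℝ := min κ τ / 16 with he
  have hm0 : 0 < min κ τ := lt_min hκ hτ
  have hmκ := min_le_left κ τ
  have hmτ := min_le_right κ τ
  have he0 : 0 < e := by positivity
  have heball : ∀ x ∈ Ω, ball x (e * bdryDist Ω x) ⊆ Ω := fun x hx =>
    (ball_subset_ball (mul_le_mul_of_nonneg_right (by linarith) (hd x hx).le)).trans (hκΩ x hx)
  have hw0 : ∀ x ∈ Ω, distWeight F φ x ≠ 0 := fun x hx => by
    rw [distWeight_eq (hdF x hx)]
    exact (ENNReal.ofReal_pos.2 (hφpos _ (hdF x hx))).ne'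
  obtain ⟨C₁, hC₁top, hC₁⟩ := hΩ.exists_weighted_poincare (w := distWeight F φ) hμ hne he0
    (by linarith) heball (measurable_distWeight hφpos hφmono) hw0
    (fun x => ENNReal.ofReal_ne_top) (lintegral_distWeight_ne_top hμ hΩ.2.2.1 hφpos hφmono hF0)
    (exists_distWeight_le hφpos hφmono hφgrowth hF0 hFΩ hd) hp0
  obtain ⟨C₂, hC₂⟩ := exists_localEnergy_le_truncSeminorm hμ hΩo.measurableSet hd hφpos hφmono
    hφgrowth hF0 hFΩ hs.le hp0 (show 8 * e ≤ 1 / 2 by linarith) (show 8 * e ≤ τ by linarith)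
  have hCtop : (C₁ * C₂) ^ (1 / p) ≠ ∞ := ENNReal.rpow_ne_top_of_nonneg (by positivity)
    (ENNReal.mul_ne_top hC₁top ENNReal.coe_ne_top)
  refine ⟨((C₁ * C₂) ^ (1 / p)).toNNReal, fun u hu => ?_⟩
  -- Both sides depend only on the class of `u` almost everywhere on `Ω`, so a Borel representative
  -- may be used.
  rw [ENNReal.coe_toNNReal hCtop, truncSeminorm_congr_ae _ _ _ _ hu.ae_eq_mk]
  have hum : Measurable (hu.mk u) := hu.stronglyMeasurable_mk.measurable
  obtain ⟨a, ha⟩ := hC₁ (hu.mk u) hum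
  refine (iInf_le _ a).trans ?_
  have hcongr : (fun x => u x - a) =ᵐ[weightedMeasure μ Ω F φ] fun x => hu.mk u x - a := by
    refine (withDensity_absolutelyContinuous _ _).ae_le ?_
    filter_upwards [hu.ae_eq_mk] with x hx
    rw [hx]
  rw [eLpNorm_congr_ae hcongr, eLpNorm_weightedMeasure hφpos hφmono hΩo.measurableSet hdF hp0
    (hum.sub_const a)]
  calc (∫⁻ x in Ω, distWeight F φ x * ‖hu.mk u x - a‖ₑ ^ p ∂μ) ^ (1 / p)
      ≤ (C₁ * (C₂ * truncSeminorm μ Ω s p τ (minWeight Ω F φ (s * p)) (hu.mk u) ^ p)) ^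
          (1 / p) := by
        gcongr
        refine ha.trans ?_
        gcongr
        exact hC₂ _
    _ = _ := by
        rw [← mul_assoc, ENNReal.mul_rpow_of_nonneg _ _ (by positivity : 0 ≤ 1 / p),
          ← ENNReal.rpow_mul, one_div, mul_inv_cancel₀ hp0.ne', ENNReal.rpow_one]
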